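/- Let $n\ge 3$ and let $S_n$ be the set of monic complex polynomials of degree $n$ all of whose zeros lie in the closed unit disk. For a polynomial $p$ of degree at least $2$ and $a\in\mathbb C$ put $$|p|_a=\min\{|a-w|: p'(w)=0\},\qquad d(p)=\max\{|p|_z: p(z)=0\}.$$ For monic polynomials $p(z)=\prod_{i=1}^n(z-z_i)$ and $q(z)=\prod_{i=1}^n(z-\zeta_i)$ put $\Delta(p,q)=\min_{\sigma}\max_{1\le i\le n}|z_i-\zeta_{\sigma(i)}|$, where $\sigma$ runs over all permutations of $\{1,\dots,n\}$. A polynomial $p\in S_n$ is called linearly inextensible if there are $\varepsilon>0$, $C\ge 0$ and $\kappa>0$ such that $d(q)\le d(p)+C\,\Delta(q,p)^{1+\kappa}$ for all $q\in S_n$ with $\Delta(q,p)<\varepsilon$. A complex matrix $(m_{ij})$ is called positively singular if there are real numbers $\mu_i\ge 0$, not all $0$, such that $\sum_i\mu_i m_{ij}=0$ for every $j$. Let $p(z)=\prod_{i=1}^n(z-z_i)\in S_n$ with $p'(z)=n\prod_{j=1}^{n-1}(z-w_j)$, and assume that both $p$ and $p'$ have only simple zeros. For $1\le i\le n$ let $A(p;z_i)$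 be the complex matrix with columns indexed by $k\in\{1,\dots,n\}$ and with the following rows. - For every $j$ with $|w_j-z_i|=|p|_{z_i}$ there is a row whose $k$-th entry is $$-\frac{1}{w_j-z_i}\left[1+\frac{p(w_j)}{(w_j-z_i)^2p''(w_j)}\right]\ \text{ if } k=i,\qquad -\frac{p(w_j)}{(w_j-z_i)(w_j-z_k)^2p''(w_j)}\ \text{ if } k\ne i.$$ - For every $s\in\{1,\dots,n\}$ with $|z_s|=1$ there is a row whose $s$-th entry is $-\overline{z_s}$ and whose other entries are $0$. Suppose that the zeros are labeled so that, for some $t\in\{1,\dots,n\}$, $|p|_{z_i}=d(p)$ for $1\le i\le t$ and $|p|_{z_i}<d(p)$ for $t<i\le n$. **Theorem.** The polynomial $p$ is linearly inextensible if and only if each of the matrices $A(p;z_i)$, $1\le i\le t$, is positively singular. -/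

import Mathlib

open Polynomial

noncomputable section

namespace Sendov

/-- The class `S_n`: monic complex polynomials of degree `n` with all zeros in the closed unit
disk. -/
def S (n : ℕ) : Set ℂ[X] :=
  {p | p.Monic ∧ p.natDegree = n ∧ ∀ z : ℂ, p.IsRoot z → ‖z‖ ≤ 1}

/-- All complex zeros of `p` are simple. -/
def SimpleZeros (p : ℂ[X]) : Prop :=
  ∀ z : ℂ, p.IsRoot z → p.rootMultiplicity z = 1

/-- `Δ(p, q)`: the least value of `max_i |z_i - ζ_i|` over all labelings `z_1, …, z_n` and
`ζ_1, …, ζ_n` of the zeros (with multiplicity) of the monic polynomials `p` and `q` of degree `n`.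
The norm on `Fin n → ℂ` is the maximum norm, and for monic `p`, `q` of degree `n` the set below is
finite and nonempty, so that the infimum is a minimum. -/
def rootDist (n : ℕ) (p q : ℂ[X]) : ℝ :=
  sInf {δ : ℝ | ∃ z ζ : Fin n → ℂ, p = ∏ i, (X - C (z i)) ∧ q = ∏ i, (X - C (ζ i)) ∧
    δ = ‖z - ζ‖}

/-- `|p|_a = min {|a - w| : p'(w) = 0}`, the distance from `a` to the (finite, nonempty if
`deg p ≥ 2`) set of critical points of `p`. -/
def critDist (p : ℂ[X]) (a : ℂ) : ℝ :=
  Metric.infDist a {w : ℂ | (derivative p).IsRoot w}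

/-- `d(p) = max {|p|_z : p(z) = 0}`; the supremum is over a finite nonempty set if `deg p ≥ 1`. -/
def d (p : ℂ[X]) : ℝ :=
  sSup (critDist p '' {z : ℂ | p.IsRoot z})

/-- `p` is linearly inextensible in `S_n`. -/
def LinearlyInextensible (n : ℕ) (p : ℂ[X]) : Prop :=
  p ∈ S n ∧ ∃ ε : ℝ, 0 < ε ∧ ∃ c : ℝ, 0 ≤ c ∧ ∃ κ : ℝ, 0 < κ ∧
    ∀ q ∈ S n, rootDist n q p < ε → d q ≤ d p + c * rootDist n q p ^ (1 + κ)

/-- A complex matrix is positively singular if some nontrivial combination of its rows with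
nonnegative real coefficients vanishes. -/
def PositivelySingular {ι κ : Type*} [Fintype ι] (M : Matrix ι κ ℂ) : Prop :=
  ∃ μ : ι → ℝ, (∀ i, 0 ≤ μ i) ∧ (∃ i, μ i ≠ 0) ∧ ∀ j, ∑ i, (μ i : ℂ) * M i j = 0

/-- The coefficient `α_k(w; z_i)`, where `z` lists the zeros of `p` and `w` is a critical point. -/
def alpha {n : ℕ} (p : ℂ[X]) (z : Fin n → ℂ) (i : Fin n) (w : ℂ) (k : Fin n) : ℂ :=
  if k = i then
    -(1 / (w - z i)) *
      (1 + p.eval w / ((w - z i) ^ 2 * (derivative (derivative p)).eval w))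
  else
    -(p.eval w / ((w - z i) * (w - z k) ^ 2 * (derivative (derivative p)).eval w))

/-- The matrix `A(p; z_i)`, where `z` lists the zeros and `w` the critical points of `p`. It has one
row for every critical point `w_j` at distance `|p|_{z_i}` from `z_i`, one row for every zero `z_k`
on the unit circle, and one column for every zero. -/
def A {n : ℕ} (p : ℂ[X]) (z : Fin n → ℂ) (w : Fin (n - 1) → ℂ) (i : Fin n) :
    Matrix ({j : Fin (n - 1) // ‖w j - z i‖ = critDist p (z i)} ⊕ {k : Fin n // ‖z k‖ = 1})
      (Fin n) ℂ :=
  fun row l =>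
    match row with
    | Sum.inl j => alpha p z i (w j) l
    | Sum.inr k => if l = k then -(starRingEnd ℂ) (z k) else 0

end Sendov

end

/-!
Label the zeros of a polynomial near `p = ∏ (X - z k)` as `z k + h k`. Near a simple critical point
`x` of `p`, which is not a zero of `p`, the critical points of the perturbed polynomial solve
`∑ 1 / (x + u - z k - h k) = 0`, and expanding this equation to second order shows that they are
`x + critVel z x h` up to an error `O(‖h‖ ^ 2)` (`exists_norm_sub_critVel_le`). So the rows of
`A (p; z i)` that belong to critical points, applied to `h`, give the first-order relative change of
the smallest distances from `z i` to critical points (`sum_alpha_mul`), and the rows that belong to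
zeros on the unit circle give the first-order motion of these zeros towards the interior of the disk.
No differentiable branch of critical points is needed: by continuity there is a critical point of
the perturbed polynomial near each one of `p` (`eventually_exists_isRoot_near`), and all of them are
near one of `p` (`eventually_forall_isRoot_near`).

If `A (p; z i)` is not positively singular, Gordan's alternative
(`exists_re_pos_of_not_positivelySingular`) provides a direction `v` on which all rows have positive
real part. Moving the zeros along `s • v` with small `s > 0` keeps them in the disk, and makes the
distance from `z i` to the critical points grow linearly in `s`, faster than `s ^ (1 + κ)`
(`LinearlyInextensible.positivelySingular_A`).

If `A (p; z i)` is positively singular with multipliers `μ`, then the real parts of the rows, applied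
to a displacement `h` that stays in the disk, have a vanishing combination with nonnegative
coefficients. The rows of zeros on the circle contribute nonnegative terms, so some nearest critical
point does not recede at first order (`PositivelySingular.exists_re_sum_alpha_nonpos`), and its
distance grows by at most `O(‖h‖ ^ 2)` (`exists_critDist_le_of_re_nonpos`). The zeros at which
`critDist` is smaller than `d p` do not matter by continuity (`eventually_critDist_le`), which proves
linear inextensibility with `κ = 1` (`linearlyInextensible_ofZeros`).
-/

open Filter Topology

namespace Sendov

/-! ### Polynomials given by their zeros -/

/-- The monic polynomial `∏ (X - ζ i)` with prescribed zeros `ζ`, listed with multiplicity. -/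
noncomputable def ofZeros {ι : Type*} [Fintype ι] (ζ : ι → ℂ) : ℂ[X] := ∏ i, (X - C (ζ i))

section ofZeros

variable {ι : Type*} [Fintype ι]

lemma ofZeros_monic (ζ : ι → ℂ) : (ofZeros ζ).Monic :=
  monic_prod_X_sub_C ζ Finset.univ

lemma natDegree_ofZeros (ζ : ι → ℂ) : (ofZeros ζ).natDegree = Fintype.card ι := by
  simp [ofZeros, natDegree_prod_of_monic _ _ fun i _ => monic_X_sub_C (ζ i)]

lemma eval_ofZeros (ζ : ι → ℂ) (x : ℂ) : (ofZeros ζ).eval x = ∏ i, (x - ζ i) := by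
  simp [ofZeros, eval_prod]

lemma isRoot_ofZeros {ζ : ι → ℂ} {x : ℂ} : (ofZeros ζ).IsRoot x ↔ ∃ i, x = ζ i := by
  simp [IsRoot, eval_ofZeros, Finset.prod_eq_zero_iff, sub_eq_zero]

lemma ofZeros_comp_equiv {κ : Type*} [Fintype κ] (σ : κ ≃ ι) (ζ : ι → ℂ) :
    ofZeros (ζ ∘ σ) = ofZeros ζ :=
  Equiv.prod_comp σ fun i => X - C (ζ i)

lemma eval_derivative_ofZeros [DecidableEq ι] (ζ : ι → ℂ) (x : ℂ) :
    (derivative (ofZeros ζ)).eval x = ∑ i, ∏ j ∈ Finset.univ.erase i, (x - ζ j) := by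
  simp [ofZeros, derivative_prod_finset, eval_finsetSum, eval_prod]

lemma continuous_eval_derivative_ofZeros {Y : Type*} [TopologicalSpace Y] {ζ : Y → ι → ℂ}
    {x : Y → ℂ} (hζ : Continuous ζ) (hx : Continuous x) :
    Continuous fun y => (derivative (ofZeros (ζ y))).eval (x y) := by
  classical
  simp only [eval_derivative_ofZeros]
  fun_prop

/-- The logarithmic derivative of `∏ (X - ζ i)`. -/
lemma eval_derivative_ofZeros_eq_mul {ζ : ι → ℂ} {x : ℂ} (hx : ∀ i, x ≠ ζ i) :
    (derivative (ofZeros ζ)).eval x = (ofZeros ζ).eval x * ∑ i, 1 / (x - ζ i) := by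
  classical
  rw [eval_derivative_ofZeros, eval_ofZeros, Finset.mul_sum]
  refine Finset.sum_congr rfl fun i _ => ?_
  rw [← Finset.mul_prod_erase _ _ (Finset.mem_univ i)]
  field_simp [sub_ne_zero.2 (hx i)]

lemma sum_inv_eq_zero_of_isRoot {ζ : ι → ℂ} {x : ℂ} (hx : ∀ i, x ≠ ζ i)
    (h : (derivative (ofZeros ζ)).IsRoot x) : ∑ i, 1 / (x - ζ i) = 0 := by
  have h' := eval_derivative_ofZeros_eq_mul hx
  rw [h.eq_zero, eval_ofZeros] at h'
  exact (mul_eq_zero.1 h'.symm).resolve_left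
    (Finset.prod_ne_zero_iff.2 fun i _ => sub_ne_zero.2 (hx i))

/-- At a critical point `x` of `p = ∏ (X - ζ i)` that is not a zero of `p`, the derivative of
`p' = p · ∑ 1 / (X - ζ i)` loses the term with `p' x`. -/
lemma eval_derivative_derivative_ofZeros {ζ : ι → ℂ} {x : ℂ} (hx : ∀ i, x ≠ ζ i)
    (h : (derivative (ofZeros ζ)).IsRoot x) :
    (derivative (derivative (ofZeros ζ))).eval x =
      -((ofZeros ζ).eval x * ∑ i, 1 / (x - ζ i) ^ 2) := by
  have h1 : HasDerivAt (fun y => (derivative (ofZeros ζ)).eval y)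
      ((derivative (derivative (ofZeros ζ))).eval x) x := Polynomial.hasDerivAt _ _
  have h2 : HasDerivAt (fun y => (ofZeros ζ).eval y * ∑ i, 1 / (y - ζ i))
      ((derivative (ofZeros ζ)).eval x * ∑ i, 1 / (x - ζ i) +
        (ofZeros ζ).eval x * ∑ i, (-1 / (x - ζ i) ^ 2)) x := by
    refine (Polynomial.hasDerivAt _ _).mul (HasDerivAt.fun_sum fun i _ => ?_)
    simp only [one_div]
    exact ((hasDerivAt_id x).sub_const (ζ i)).fun_inv (sub_ne_zero.2 (hx i))
  have h3 : (fun y => (derivative (ofZeros ζ)).eval y) =ᶠ[𝓝 x]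
      fun y => (ofZeros ζ).eval y * ∑ i, 1 / (y - ζ i) := by
    have : ∀ᶠ y in 𝓝 x, ∀ i, y ≠ ζ i := eventually_all.2 fun i => isOpen_ne.mem_nhds (hx i)
    filter_upwards [this] with y hy using eval_derivative_ofZeros_eq_mul hy
  rw [h1.unique (h2.congr_of_eventuallyEq h3), h.eq_zero, zero_mul, zero_add, ← mul_neg,
    ← Finset.sum_neg_distrib]
  simp only [neg_div]

end ofZeros

lemma exists_eq_ofZeros {q : ℂ[X]} (hq : q.Monic) {m : ℕ} (hm : q.natDegree = m) :
    ∃ ζ : Fin m → ℂ, q = ofZeros ζ := by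
  have hs := IsAlgClosed.splits q
  have hc : q.roots.toList.length = m := by
    rw [Multiset.length_toList, ← hm, hs.natDegree_eq_card_roots]
  subst hc
  refine ⟨q.roots.toList.get, ?_⟩
  rw [ofZeros, ← List.prod_ofFn, List.ofFn_comp' q.roots.toList.get fun a => X - C a]
  simp only [List.ofFn_get]
  rw [← Multiset.prod_coe, ← Multiset.map_coe, Multiset.coe_toList]
  exact hs.eq_prod_roots_of_monic hq

lemma exists_derivative_eq_ofZeros {n : ℕ} (hn : n ≠ 0) (ζ : Fin n → ℂ) :
    ∃ v : Fin (n - 1) → ℂ, derivative (ofZeros ζ) = C (n : ℂ) * ofZeros v := by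
  have hn' : (n : ℂ) ≠ 0 := Nat.cast_ne_zero.2 hn
  have hd : (derivative (ofZeros ζ)).natDegree = n - 1 := by
    rw [natDegree_derivative, natDegree_ofZeros, Fintype.card_fin]
  have hl : (derivative (ofZeros ζ)).leadingCoeff = n := by
    rw [leadingCoeff, hd, coeff_derivative, Nat.sub_add_cancel (Nat.one_le_iff_ne_zero.2 hn)]
    have := (ofZeros_monic ζ).coeff_natDegree
    rw [natDegree_ofZeros, Fintype.card_fin] at this
    rw [this, one_mul, ← Nat.cast_add_one, Nat.sub_add_cancel (Nat.one_le_iff_ne_zero.2 hn)]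
  have hm : (C (n : ℂ)⁻¹ * derivative (ofZeros ζ)).Monic := by
    rw [Monic, leadingCoeff_mul, leadingCoeff_C, hl, inv_mul_cancel₀ hn']
  obtain ⟨v, hv⟩ := exists_eq_ofZeros hm (m := n - 1)
    (by rw [natDegree_C_mul (inv_ne_zero hn'), hd])
  refine ⟨v, ?_⟩
  rw [← hv, ← mul_assoc, ← C_mul, mul_inv_cancel₀ hn', C_1, one_mul]

lemma isRoot_derivative_iff_of_eq {n : ℕ} (hn : n ≠ 0) {q : ℂ[X]} {v : Fin (n - 1) → ℂ}
    (h : derivative q = C (n : ℂ) * ofZeros v) {x : ℂ} :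
    (derivative q).IsRoot x ↔ ∃ j, x = v j := by
  rw [← isRoot_ofZeros, h]
  simp [IsRoot, hn]

lemma SimpleZeros.eval_derivative_ne_zero {p : ℂ[X]} (hp : SimpleZeros p) (h0 : p ≠ 0) {a : ℂ}
    (ha : p.IsRoot a) : (derivative p).eval a ≠ 0 := fun h =>
  ((one_lt_rootMultiplicity_iff_isRoot h0).2 ⟨ha, h⟩).ne' (hp a ha)

lemma SimpleZeros.injective {ι : Type*} [Fintype ι] {z : ι → ℂ} (h : SimpleZeros (ofZeros z)) :
    Function.Injective z := by
  classical
  intro i j hij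
  by_contra hne
  refine h.eval_derivative_ne_zero (ofZeros_monic z).ne_zero (isRoot_ofZeros.2 ⟨i, rfl⟩) ?_
  rw [eval_derivative_ofZeros]
  refine Finset.sum_eq_zero fun k _ => ?_
  by_cases hk : k = i
  · exact Finset.prod_eq_zero (i := j) (by simp [hk, Ne.symm hne]) (by simp [hij])
  · exact Finset.prod_eq_zero (i := i) (by simp [Ne.symm hk]) (by simp)

lemma ne_of_isRoot_derivative {ι : Type*} [Fintype ι] {z : ι → ℂ} (h : SimpleZeros (ofZeros z))
    {x : ℂ} (hx : (derivative (ofZeros z)).IsRoot x) (k : ι) : x ≠ z k := by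
  rintro rfl
  exact h.eval_derivative_ne_zero (ofZeros_monic z).ne_zero (isRoot_ofZeros.2 ⟨k, rfl⟩) hx

lemma ofZeros_mem_S {n : ℕ} {ζ : Fin n → ℂ} : ofZeros ζ ∈ S n ↔ ∀ i, ‖ζ i‖ ≤ 1 := by
  refine ⟨fun h i => h.2.2 _ (isRoot_ofZeros.2 ⟨i, rfl⟩), fun h =>
    ⟨ofZeros_monic ζ, by rw [natDegree_ofZeros, Fintype.card_fin], ?_⟩⟩
  intro z hz
  obtain ⟨i, rfl⟩ := isRoot_ofZeros.1 hz
  exact h i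

/-! ### The metric quantities -/

lemma critDist_le {q : ℂ[X]} {a v : ℂ} (hv : (derivative q).IsRoot v) : critDist q a ≤ ‖v - a‖ := by
  rw [← dist_eq_norm, dist_comm]
  exact Metric.infDist_le_dist_of_mem hv

lemma exists_critDist_eq {n : ℕ} (hn : 2 ≤ n) (ζ : Fin n → ℂ) (a : ℂ) :
    ∃ v, (derivative (ofZeros ζ)).IsRoot v ∧ critDist (ofZeros ζ) a = ‖v - a‖ := by
  obtain ⟨v, hv⟩ := exists_derivative_eq_ofZeros (by omega) ζ
  have hset : {x | (derivative (ofZeros ζ)).IsRoot x} = Set.range v := by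
    ext x
    exact (isRoot_derivative_iff_of_eq (by omega) hv).trans (by simp [eq_comm])
  have hne : (Set.range v).Nonempty := ⟨v ⟨0, by omega⟩, Set.mem_range_self _⟩
  obtain ⟨y, hy, hd⟩ := (Set.finite_range v).isCompact.exists_infDist_eq_dist hne a
  refine ⟨y, ?_, ?_⟩
  · rw [← hset] at hy
    exact hy
  · rw [critDist, hset, hd, dist_eq_norm, norm_sub_rev]

lemma le_d_ofZeros {n : ℕ} (ζ : Fin n → ℂ) (i : Fin n) :
    critDist (ofZeros ζ) (ζ i) ≤ d (ofZeros ζ) := by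
  have hset : {x | (ofZeros ζ).IsRoot x} = Set.range ζ := by
    ext x
    exact isRoot_ofZeros.trans (by simp [eq_comm])
  refine le_csSup ?_ ⟨ζ i, isRoot_ofZeros.2 ⟨i, rfl⟩, rfl⟩
  rw [hset]
  exact ((Set.finite_range ζ).image _).bddAbove

lemma d_ofZeros_le {n : ℕ} (hn : n ≠ 0) {ζ : Fin n → ℂ} {b : ℝ}
    (h : ∀ i, critDist (ofZeros ζ) (ζ i) ≤ b) : d (ofZeros ζ) ≤ b := by
  refine csSup_le ⟨_, ζ ⟨0, by omega⟩, isRoot_ofZeros.2 ⟨_, rfl⟩, rfl⟩ ?_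
  rintro _ ⟨x, hx, rfl⟩
  obtain ⟨i, rfl⟩ := isRoot_ofZeros.1 hx
  exact h i

lemma rootDist_ofZeros_le {n : ℕ} (ζ z : Fin n → ℂ) :
    rootDist n (ofZeros ζ) (ofZeros z) ≤ ‖ζ - z‖ :=
  csInf_le ⟨0, by rintro _ ⟨_, _, _, _, rfl⟩; exact norm_nonneg _⟩ ⟨ζ, z, rfl, rfl, rfl⟩

/-- When the zeros `z` are simple, the minimum in `rootDist` is attained for the given labeling of
`z` and a suitable labeling of the zeros of `q`. -/
lemma exists_rootDist_eq {n : ℕ} {q : ℂ[X]} (hq : q ∈ S n) {z : Fin n → ℂ}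
    (hz : Function.Injective z) :
    ∃ ζ : Fin n → ℂ, q = ofZeros ζ ∧ rootDist n q (ofZeros z) = ‖ζ - z‖ := by
  have hfin (r : ℂ[X]) (hr : r ≠ 0) : {ζ : Fin n → ℂ | r = ofZeros ζ}.Finite := by
    refine (Set.Finite.pi' (fun _ => r.roots.toFinset.finite_toSet)).subset ?_
    rintro ζ rfl i
    simpa [hr] using isRoot_ofZeros.2 ⟨i, rfl⟩
  set D : Set ℝ := {δ : ℝ | ∃ ζ z' : Fin n → ℂ, q = ofZeros ζ ∧ ofZeros z = ofZeros z' ∧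
    δ = ‖ζ - z'‖}
  have hDfin : D.Finite := by
    refine (((hfin q hq.1.ne_zero).prod (hfin (ofZeros z) (ofZeros_monic z).ne_zero)).image
      fun y => ‖y.1 - y.2‖).subset ?_
    rintro _ ⟨ζ, z', h, h', rfl⟩
    exact ⟨(ζ, z'), ⟨h, h'⟩, rfl⟩
  have hDne : D.Nonempty := by
    obtain ⟨ζ, h⟩ := exists_eq_ofZeros hq.1 hq.2.1
    exact ⟨_, ζ, z, h, rfl, rfl⟩
  obtain ⟨ζ, z', h, h', hδ⟩ : sInf D ∈ D := hDne.csInf_mem hDfin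
  have hex (i) : ∃ j, z i = z' j := isRoot_ofZeros.1 (h' ▸ isRoot_ofZeros.2 ⟨i, rfl⟩)
  choose σ hσ using hex
  have hinj : Function.Injective σ := fun i j hij => hz (by rw [hσ i, hσ j, hij])
  let e := Equiv.ofBijective σ (Finite.injective_iff_bijective.1 hinj)
  refine ⟨ζ ∘ e, by rw [ofZeros_comp_equiv, h], ?_⟩
  have hze : z = z' ∘ e := funext hσ
  have hnorm (y : Fin n → ℂ) : ‖y ∘ e‖ = ‖y‖ := by
    simp only [Pi.norm_def, Function.comp_apply]
    conv_rhs => rw [← Finset.image_univ_equiv e, Finset.sup_image]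
    rfl
  calc rootDist n q (ofZeros z) = sInf D := rfl
    _ = ‖(ζ - z') ∘ e‖ := by rw [hδ, hnorm]
    _ = ‖ζ ∘ e - z‖ := by rw [hze]; rfl

/-! ### First-order motion of the critical points -/

/-- The derivative, in the direction `h`, of a critical point `x` of `∏ (X - z k)` as a function of
the zeros `z`. It comes from differentiating `∑ 1 / (x - z k) = 0` implicitly. -/
noncomputable def critVel {ι : Type*} [Fintype ι] (z : ι → ℂ) (x : ℂ) (h : ι → ℂ) : ℂ :=
  (∑ k, h k / (x - z k) ^ 2) / ∑ k, 1 / (x - z k) ^ 2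

lemma critVel_smul {ι : Type*} [Fintype ι] (z : ι → ℂ) (x : ℂ) (h : ι → ℂ) (s : ℝ) :
    critVel z x (s • h) = s * critVel z x h := by
  simp only [critVel, Pi.smul_apply, Complex.real_smul, mul_div_assoc, ← Finset.mul_sum]

/-- The row `alpha` of the matrix `A` is the logarithmic derivative of `x - z i`, where the critical
point `x` moves along with the zeros. -/
lemma sum_alpha_mul {n : ℕ} {z : Fin n → ℂ} {x : ℂ} (hx : ∀ k, x ≠ z k)
    (hc : (derivative (ofZeros z)).IsRoot x)
    (hs : (derivative (derivative (ofZeros z))).eval x ≠ 0) (i : Fin n) (h : Fin n → ℂ) :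
    ∑ k, alpha (ofZeros z) z i x k * h k = (critVel z x h - h i) / (x - z i) := by
  have hd := eval_derivative_derivative_ofZeros hx hc
  set T := ∑ k, 1 / (x - z k) ^ 2 with hT
  set P := (ofZeros z).eval x with hP
  have hP0 : P ≠ 0 := fun h0 => hs (by rw [hd, h0]; simp)
  have hT0 : T ≠ 0 := fun h0 => hs (by rw [hd, h0]; simp)
  have hxi (k) : x - z k ≠ 0 := sub_ne_zero.2 (hx k)
  have ha (k) : alpha (ofZeros z) z i x k * h k =
      (h k / (x - z k) ^ 2 / T - if k = i then h k else 0) / (x - z i) := by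
    unfold alpha
    rw [hd, ← hP]
    have h1 := hxi k
    have h2 := hxi i
    split_ifs with hk
    · subst hk
      field_simp
      ring
    · field_simp
      ring
  simp only [ha, ← Finset.sum_div, Finset.sum_sub_distrib, critVel, ← hT, Finset.sum_ite_eq',
    Finset.mem_univ, if_true]

lemma norm_inv_add_sub_le {a x : ℂ} {r : ℝ} (hr : 0 < r) (ha : r ≤ ‖a‖) (hx : ‖x‖ ≤ r / 2) :
    ‖1 / (a + x) - (1 / a - x / a ^ 2)‖ ≤ 2 / r ^ 3 * ‖x‖ ^ 2 := by
  have hax : r / 2 ≤ ‖a + x‖ := by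
    have := norm_sub_le (a + x) x
    rw [add_sub_cancel_right] at this
    linarith
  have ha0 : a ≠ 0 := norm_pos_iff.1 (hr.trans_le ha)
  have hax0 : a + x ≠ 0 := norm_pos_iff.1 ((half_pos hr).trans_le hax)
  have : 1 / (a + x) - (1 / a - x / a ^ 2) = x ^ 2 / (a ^ 2 * (a + x)) := by
    field_simp
    ring
  rw [this, norm_div, norm_pow, norm_mul, norm_pow]
  calc ‖x‖ ^ 2 / (‖a‖ ^ 2 * ‖a + x‖) ≤ ‖x‖ ^ 2 / (r ^ 2 * (r / 2)) := by gcongr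
    _ = 2 / r ^ 3 * ‖x‖ ^ 2 := by field_simp

/-- Every critical point close to a simple critical point `x` follows the linear prediction
`critVel` up to a quadratic error. This is the second-order expansion of the equation
`∑ 1 / (x + u - z k - h k) = 0`. -/
lemma exists_norm_sub_critVel_le {ι : Type*} [Fintype ι] {z : ι → ℂ} {x : ℂ} (hx : ∀ k, x ≠ z k)
    (hc : (derivative (ofZeros z)).IsRoot x)
    (hs : (derivative (derivative (ofZeros z))).eval x ≠ 0) :
    ∃ K : ℝ, 0 ≤ K ∧ ∀ᶠ ρ : ℝ in 𝓝[>] 0, ∀ (h : ι → ℂ) (u : ℂ), ‖h‖ < ρ → ‖u‖ < ρ →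
      (derivative (ofZeros (z + h))).IsRoot (x + u) → ‖u - critVel z x h‖ ≤ K * ‖h‖ ^ 2 := by
  set T := ∑ k, 1 / (x - z k) ^ 2 with hT
  have hT0 : 0 < ‖T‖ := norm_pos_iff.2 fun h0 => hs (by
    rw [eval_derivative_derivative_ofZeros hx hc, ← hT, h0]; simp)
  obtain ⟨r, hr, hrx⟩ : ∃ r : ℝ, 0 < r ∧ ∀ k, r ≤ ‖x - z k‖ := by
    have : ∀ᶠ r : ℝ in 𝓝[>] 0, ∀ k, r ≤ ‖x - z k‖ := eventually_all.2 fun k =>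
      nhdsWithin_le_nhds (eventually_le_nhds (norm_pos_iff.2 (sub_ne_zero.2 (hx k))))
    obtain ⟨r, h1, h2⟩ := (this.and self_mem_nhdsWithin).exists
    exact ⟨r, h2, h1⟩
  set N : ℝ := (Fintype.card ι : ℝ) with hN
  set M : ℝ := N * (2 / r ^ 3) with hM
  set c : ℝ := (2 * (N / r ^ 2) + ‖T‖) / ‖T‖ with hcdef
  have hN0 : 0 ≤ N := Nat.cast_nonneg _
  have hM0 : 0 ≤ M := by positivity
  refine ⟨M * (1 + c) ^ 2 / ‖T‖, by positivity, ?_⟩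
  have h1 : ∀ᶠ ρ : ℝ in 𝓝[>] 0, ρ ≤ r / 4 := nhdsWithin_le_nhds (eventually_le_nhds (by positivity))
  have h2 : ∀ᶠ ρ : ℝ in 𝓝[>] 0, M * (2 * ρ) ≤ ‖T‖ / 2 := by
    refine nhdsWithin_le_nhds (Tendsto.eventually_le_const (v := M * (2 * 0)) (by simpa using hT0) ?_)
    exact (by fun_prop : Continuous fun ρ : ℝ => M * (2 * ρ)).tendsto 0
  filter_upwards [h1, h2] with ρ hρ1 hρ2 h u hh hu hroot
  have hk (k) : ‖h k‖ ≤ ‖h‖ := norm_le_pi_norm h k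
  have huh (k) : ‖u - h k‖ ≤ ‖u‖ + ‖h‖ := (norm_sub_le _ _).trans (by linarith [hk k])
  have hsplit (k) : x + u - (z + h) k = (x - z k) + (u - h k) := by
    rw [Pi.add_apply]; ring
  have hne (k) : x + u ≠ (z + h) k := by
    intro h0
    have h0' := hsplit k
    rw [h0, sub_self] at h0'
    have h3 : ‖x - z k‖ = ‖u - h k‖ := by rw [eq_neg_of_add_eq_zero_left h0'.symm, norm_neg]
    linarith [hrx k, huh k]
  have hsum := sum_inv_eq_zero_of_isRoot hne hroot
  simp only [hsplit] at hsum
  have hsum0 := sum_inv_eq_zero_of_isRoot hx hc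
  set B := ∑ k, h k / (x - z k) ^ 2 with hB
  have hlin : u * T - B = ∑ k, (1 / (x - z k + (u - h k)) -
      (1 / (x - z k) - (u - h k) / (x - z k) ^ 2)) := by
    rw [Finset.sum_sub_distrib, Finset.sum_sub_distrib, hsum, hsum0, zero_sub, zero_sub, neg_neg, hT,
      hB, Finset.mul_sum, ← Finset.sum_sub_distrib]
    exact Finset.sum_congr rfl fun k _ => by ring
  have hquad : ‖u * T - B‖ ≤ M * (‖u‖ + ‖h‖) ^ 2 := by
    rw [hlin]
    calc _ ≤ ∑ _k : ι, 2 / r ^ 3 * (‖u‖ + ‖h‖) ^ 2 := norm_sum_le_of_le _ fun k _ =>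
          (norm_inv_add_sub_le hr (hrx k) (by linarith [huh k])).trans (by gcongr; exact huh k)
      _ = M * (‖u‖ + ‖h‖) ^ 2 := by simp [hM, hN]; ring
  have hBle : ‖B‖ ≤ N / r ^ 2 * ‖h‖ := by
    calc ‖B‖ ≤ ∑ _k : ι, ‖h‖ / r ^ 2 := norm_sum_le_of_le _ fun k _ => by
          rw [norm_div, norm_pow]
          gcongr
          exacts [hk k, hrx k]
      _ = N / r ^ 2 * ‖h‖ := by simp [hN]; ring
  -- For small `ρ` the quadratic error is absorbed by the term linear in `u`, so `u = O(h)`; the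
  -- error is then quadratic in `h` alone.
  have hucle : ‖u‖ ≤ c * ‖h‖ := by
    have h3 : ‖u‖ * ‖T‖ ≤ ‖u * T - B‖ + ‖B‖ := by
      rw [← norm_mul]
      simpa using norm_add_le (u * T - B) B
    have h4 : M * (‖u‖ + ‖h‖) ^ 2 ≤ ‖T‖ / 2 * (‖u‖ + ‖h‖) := by
      rw [sq, ← mul_assoc]
      gcongr
      exact (mul_le_mul_of_nonneg_left (by linarith) hM0).trans hρ2
    rw [hcdef, div_mul_eq_mul_div, le_div_iff₀ hT0]
    linarith
  have hdiv : u - critVel z x h = (u * T - B) / T := by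
    have := norm_pos_iff.1 hT0
    rw [critVel, ← hT, ← hB]
    field_simp
  rw [hdiv, norm_div, div_mul_eq_mul_div]
  gcongr
  calc ‖u * T - B‖ ≤ M * (‖u‖ + ‖h‖) ^ 2 := hquad
    _ ≤ M * (c * ‖h‖ + ‖h‖) ^ 2 := by gcongr
    _ = M * (1 + c) ^ 2 * ‖h‖ ^ 2 := by ring

/-! ### Continuity of the critical points -/

/-- The Gauss–Lucas theorem for the unit disk. -/
lemma norm_le_one_of_isRoot_derivative {ι : Type*} [Fintype ι] [Nonempty ι] {ζ : ι → ℂ}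
    (hζ : ∀ i, ‖ζ i‖ ≤ 1) {v : ℂ} (hv : (derivative (ofZeros ζ)).IsRoot v) : ‖v‖ ≤ 1 := by
  have hpos : 0 < (ofZeros ζ).natDegree := by
    rw [natDegree_ofZeros]
    exact Fintype.card_pos
  have hne : derivative (ofZeros ζ) ≠ 0 := fun h => by
    rw [derivative_eq_zero.1 h] at hpos
    exact hpos.false
  have hmem := rootSet_derivative_subset_convexHull_rootSet (natDegree_pos_iff_degree_pos.1 hpos)
    (show v ∈ (derivative (ofZeros ζ)).rootSet ℂ from
      mem_rootSet.2 ⟨hne, by rw [coe_aeval_eq_eval]; exact hv⟩)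
  have hsub : (ofZeros ζ).rootSet ℂ ⊆ Metric.closedBall 0 1 := by
    intro y hy
    have hy' : (ofZeros ζ).IsRoot y := by
      have := (mem_rootSet.1 hy).2
      rwa [coe_aeval_eq_eval] at this
    obtain ⟨i, rfl⟩ := isRoot_ofZeros.1 hy'
    simpa using hζ i
  simpa using convexHull_min hsub (convex_closedBall _ _) hmem

/-- Every critical point is the limit of critical points of nearby polynomials: otherwise the value
of the derivative there would be bounded below by `n ρ ^ (n - 1)`. -/
lemma eventually_exists_isRoot_near {n : ℕ} (hn : n ≠ 0) {z : Fin n → ℂ} {x : ℂ}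
    (hc : (derivative (ofZeros z)).IsRoot x) {ρ : ℝ} (hρ : 0 < ρ) :
    ∀ᶠ h in 𝓝 (0 : Fin n → ℂ), ∃ u : ℂ, ‖u‖ < ρ ∧ (derivative (ofZeros (z + h))).IsRoot (x + u) := by
  have hcont : Continuous fun h : Fin n → ℂ => ‖(derivative (ofZeros (z + h))).eval x‖ :=
    (continuous_eval_derivative_ofZeros (by fun_prop) continuous_const).norm
  have hlim := hcont.tendsto 0
  simp only [add_zero, hc.eq_zero, norm_zero] at hlim
  filter_upwards [hlim.eventually_lt_const (show 0 < n * ρ ^ (n - 1) by positivity)] with h hh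
  by_contra! hno
  obtain ⟨v, hv⟩ := exists_derivative_eq_ofZeros hn (z + h)
  refine hh.not_ge ?_
  rw [hv, eval_mul, eval_C, eval_ofZeros, norm_mul, Complex.norm_natCast, norm_prod]
  gcongr
  calc ρ ^ (n - 1) = ∏ _j : Fin (n - 1), ρ := by simp
    _ ≤ ∏ j, ‖x - v j‖ := Finset.prod_le_prod (fun _ _ => hρ.le) fun j _ => by
        rw [norm_sub_rev]
        by_contra! hlt
        exact hno _ hlt (by
          rw [add_sub_cancel]
          exact (isRoot_derivative_iff_of_eq hn hv).2 ⟨j, rfl⟩)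

/-- Critical points of nearby polynomials with zeros in the unit disk are close to critical points
of the given polynomial. -/
lemma eventually_forall_isRoot_near {n : ℕ} (hn : n ≠ 0) (z : Fin n → ℂ) {ρ : ℝ} (hρ : 0 < ρ) :
    ∀ᶠ h in 𝓝 (0 : Fin n → ℂ), (∀ k, ‖z k + h k‖ ≤ 1) → ∀ v,
      (derivative (ofZeros (z + h))).IsRoot v →
        ∃ x, (derivative (ofZeros z)).IsRoot x ∧ ‖v - x‖ < ρ := by
  have : NeZero n := ⟨hn⟩
  -- The derivative of `∏ (X - z k)` has no zero on this compact set, and nor have small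
  -- perturbations of it.
  have hK : IsCompact {v : ℂ | ‖v‖ ≤ 1 ∧ ∀ x, (derivative (ofZeros z)).IsRoot x → ρ ≤ ‖v - x‖} := by
    refine Metric.isCompact_of_isClosed_isBounded ?_ (Metric.isBounded_closedBall.subset
      (t := Metric.closedBall (0 : ℂ) 1) fun v hv => mem_closedBall_zero_iff.2 hv.1)
    simp only [Set.ofPred_and, Set.ofPred_forall]
    exact (isClosed_le continuous_norm continuous_const).inter <| isClosed_iInter fun x =>
      isClosed_iInter fun _ => isClosed_le continuous_const (continuous_id.sub continuous_const).norm
  have hcont : Continuous fun y : (Fin n → ℂ) × ℂ => (derivative (ofZeros (z + y.1))).eval y.2 :=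
    continuous_eval_derivative_ofZeros (by fun_prop) continuous_snd
  have hev := hK.eventually_forall_of_forall_eventually (x₀ := (0 : Fin n → ℂ))
    (P := fun h v => (derivative (ofZeros (z + h))).eval v ≠ 0) (by
      intro v hv
      refine hcont.continuousAt.eventually_ne fun h0 => ?_
      rw [add_zero] at h0
      have := hv.2 v h0
      rw [sub_self, norm_zero] at this
      exact hρ.not_ge this)
  filter_upwards [hev] with h hh hdisk v hv
  by_contra! hno
  exact hh v ⟨norm_le_one_of_isRoot_derivative (ζ := z + h) hdisk hv, hno⟩ hv

/-! ### Gordan's alternative -/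

/-- The nontrivial half of Gordan's alternative: if no nonnegative combination of the rows of `M`
vanishes, then the convex hull of the rows can be separated from `0`. -/
lemma exists_re_pos_of_not_positivelySingular {ι κ : Type*} [Fintype ι] [Fintype κ]
    {M : Matrix ι κ ℂ} (hM : ¬PositivelySingular M) :
    ∃ v : κ → ℂ, ∀ i, 0 < (∑ j, M i j * v j).re := by
  classical
  let R : ι → κ → ℂ := fun i j => M i j
  change ∃ v : κ → ℂ, ∀ i, 0 < (∑ j, R i j * v j).re
  let L : (ι → ℝ) →ₗ[ℝ] (κ → ℂ) := Fintype.linearCombination ℝ R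
  have hL (μ : ι → ℝ) (j : κ) : L μ j = ∑ i, (μ i : ℂ) * R i j := by
    simp [L, R, Fintype.linearCombination_apply, Finset.sum_apply]
  have hconv : Convex ℝ (L '' stdSimplex ℝ ι) := (convex_stdSimplex ℝ ι).linear_image L
  have hclosed : IsClosed (L '' stdSimplex ℝ ι) :=
    ((isCompact_stdSimplex ℝ ι).image L.continuous_of_finiteDimensional).isClosed
  have h0 : (0 : κ → ℂ) ∉ L '' stdSimplex ℝ ι := by
    rintro ⟨μ, ⟨hμ0, hμ1⟩, hμ⟩
    refine hM ⟨μ, hμ0, ?_, fun j => (hL μ j).symm.trans (by rw [hμ, Pi.zero_apply])⟩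
    by_contra! hall
    simp [hall] at hμ1
  obtain ⟨f, u, hu0, hu⟩ := RCLike.geometric_hahn_banach_point_closed (𝕜 := ℂ) hconv hclosed h0
  rw [map_zero, map_zero] at hu0
  refine ⟨fun j => f (Pi.single j 1), fun i => ?_⟩
  have hRi : L (Pi.single i 1) = R i := by
    simp [L, Fintype.linearCombination_apply_single]
  have hfi : f (R i) = ∑ j, R i j * f (Pi.single j 1) := by
    refine (f.toLinearMap.pi_apply_eq_sum_univ (R i)).trans (Finset.sum_congr rfl fun j _ => ?_)
    refine congrArg (fun y => R i j * f y) (funext fun k => ?_)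
    simp [Pi.single_apply, eq_comm]
  rw [← hfi, ← hRi]
  exact hu0.trans (hu _ ⟨_, single_mem_stdSimplex ℝ i, rfl⟩)

lemma sum_A_inr_mul {n : ℕ} (p : ℂ[X]) (z : Fin n → ℂ) (w : Fin (n - 1) → ℂ) (i : Fin n)
    (k : {k : Fin n // ‖z k‖ = 1}) (h : Fin n → ℂ) :
    ∑ l, A p z w i (Sum.inr k) l * h l = -(starRingEnd ℂ (z k) * h k) := by
  simp only [A, ite_mul, zero_mul, Finset.sum_ite_eq', Finset.mem_univ, if_true, neg_mul]

/-! ### Norm estimates -/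

lemma norm_add_sq_eq (a b : ℂ) :
    ‖a + b‖ ^ 2 = ‖a‖ ^ 2 + 2 * (starRingEnd ℂ a * b).re + ‖b‖ ^ 2 := by
  simp only [Complex.sq_norm, Complex.normSq_apply, Complex.add_re, Complex.add_im, Complex.mul_re,
    Complex.conj_re, Complex.conj_im]
  ring

lemma re_conj_mul_nonpos {a b : ℂ} (ha : ‖a‖ = 1) (hab : ‖a + b‖ ≤ 1) :
    (starRingEnd ℂ a * b).re ≤ 0 := by
  have h := norm_add_sq_eq a b
  have h1 : ‖a + b‖ ^ 2 ≤ 1 := pow_le_one₀ (norm_nonneg _) hab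
  rw [ha] at h
  linarith [sq_nonneg ‖b‖]

lemma eventually_norm_add_smul_le_one {a b : ℂ} (ha : ‖a‖ ≤ 1)
    (hab : ‖a‖ = 1 → (starRingEnd ℂ a * b).re < 0) :
    ∀ᶠ s : ℝ in 𝓝[>] 0, ‖a + s • b‖ ≤ 1 := by
  rcases ha.lt_or_eq with h | h
  · refine nhdsWithin_le_nhds (Tendsto.eventually_le_const (v := ‖a + (0 : ℝ) • b‖) (by simpa) ?_)
    exact (by fun_prop : Continuous fun s : ℝ => ‖a + s • b‖).tendsto 0
  · have hlim : ∀ᶠ s : ℝ in 𝓝[>] 0, 2 * (starRingEnd ℂ a * b).re + s * ‖b‖ ^ 2 ≤ 0 := by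
      refine nhdsWithin_le_nhds (Tendsto.eventually_le_const
        (v := 2 * (starRingEnd ℂ a * b).re + 0 * ‖b‖ ^ 2) (by linarith [hab h]) ?_)
      exact (by fun_prop : Continuous fun s : ℝ =>
        2 * (starRingEnd ℂ a * b).re + s * ‖b‖ ^ 2).tendsto 0
    filter_upwards [hlim, self_mem_nhdsWithin] with s hs hs0
    have hre : (starRingEnd ℂ a * s • b).re = s * (starRingEnd ℂ a * b).re := by
      rw [mul_smul_comm, Complex.real_smul, Complex.re_ofReal_mul]
    have hexp := norm_add_sq_eq a (s • b)
    rw [h, hre, norm_smul, mul_pow, Real.norm_eq_abs, sq_abs] at hexp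
    have := mul_nonpos_of_nonneg_of_nonpos (le_of_lt hs0) hs
    exact (sq_le_one_iff₀ (norm_nonneg _)).1 (by linarith)

lemma norm_one_add_le (x : ℂ) : ‖1 + x‖ ≤ 1 + x.re + ‖x‖ ^ 2 / 2 := by
  have h := norm_add_sq_eq 1 x
  rw [map_one, one_mul, norm_one] at h
  exact abs_le_of_sq_le_sq' (by nlinarith [sq_nonneg (x.re + ‖x‖ ^ 2 / 2)])
    (by nlinarith [sq_nonneg ‖1 + x‖]) |>.2

/-- A point moving away from `0` at first order, or starting outside the closed disk of radius `D`,
escapes from every disk of radius `D + o(s)`. -/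
lemma eventually_add_lt_norm {a b : ℂ} {D K : ℝ} {g : ℝ → ℝ}
    (hg : Tendsto (fun s => g s / s) (𝓝[>] 0) (𝓝 0)) (ha : a ≠ 0)
    (h : D < ‖a‖ ∨ D = ‖a‖ ∧ 0 < (b / a).re) :
    ∀ᶠ s : ℝ in 𝓝[>] 0, ∀ e : ℂ, ‖e‖ ≤ K * s ^ 2 → D + g s < ‖a + s • b + e‖ := by
  have hs : Tendsto (fun s : ℝ => s) (𝓝[>] 0) (𝓝 0) := nhdsWithin_le_nhds
  have hlower (s : ℝ) (e : ℂ) (he : ‖e‖ ≤ K * s ^ 2) :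
      ‖a + s • b‖ - K * s ^ 2 ≤ ‖a + s • b + e‖ := by
    have := norm_sub_le (a + s • b + e) e
    rw [add_sub_cancel_right] at this
    linarith
  rcases h with h | ⟨rfl, h⟩
  · have hlim : Tendsto (fun s : ℝ => D + g s / s * s + K * s ^ 2 - ‖a + s • b‖) (𝓝[>] 0)
        (𝓝 (D + 0 * 0 + K * 0 ^ 2 - ‖a + (0 : ℝ) • b‖)) :=
      ((tendsto_const_nhds.add (hg.mul hs)).add ((hs.pow 2).const_mul K)).sub
        (tendsto_const_nhds.add (hs.smul_const b)).norm
    filter_upwards [hlim.eventually_lt_const (u := 0) (by simpa using h), self_mem_nhdsWithin]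
      with s hs1 hs0 e he
    rw [div_mul_cancel₀ _ (ne_of_gt hs0)] at hs1
    linarith [hlower s e he]
  · have ha' : 0 < ‖a‖ := norm_pos_iff.2 ha
    have hlim : Tendsto (fun s : ℝ => g s / s + K * s) (𝓝[>] 0) (𝓝 (0 + K * 0)) :=
      hg.add (hs.const_mul K)
    filter_upwards [hlim.eventually_lt_const (u := ‖a‖ * (b / a).re)
      (by simpa using mul_pos ha' h), self_mem_nhdsWithin] with s hs1 hs0 e he
    have hs0' : 0 < s := hs0
    have h1 : ‖a‖ * (1 + s * (b / a).re) ≤ ‖a + s • b‖ := by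
      have heq : a + s • b = a * (1 + s * (b / a)) := by
        rw [Complex.real_smul]
        field_simp
      rw [heq, norm_mul]
      gcongr
      simpa [Complex.re_ofReal_mul] using Complex.re_le_norm (1 + s * (b / a))
    have h2 := mul_lt_mul_of_pos_right hs1 hs0'
    rw [add_mul, div_mul_cancel₀ _ hs0'.ne'] at h2
    linarith [hlower s e he]

/-! ### Deforming along an extending direction -/

/-- If the distance from `z i` to the critical points is `d p` and `A` is not positively singular,
then moving the zeros along the direction provided by Gordan's alternative keeps them in the disk and
increases that distance linearly. -/
lemma LinearlyInextensible.positivelySingular_A {n : ℕ} (hn : 2 ≤ n) {z : Fin n → ℂ}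
    (hsimple : SimpleZeros (ofZeros z)) (hsimple' : SimpleZeros (derivative (ofZeros z)))
    {w : Fin (n - 1) → ℂ} (hw : derivative (ofZeros z) = C (n : ℂ) * ofZeros w)
    (hp : LinearlyInextensible n (ofZeros z)) {i : Fin n}
    (hi : critDist (ofZeros z) (z i) = d (ofZeros z)) :
    PositivelySingular (A (ofZeros z) z w i) := by
  by_contra hM
  obtain ⟨v, hv⟩ := exists_re_pos_of_not_positivelySingular hM
  obtain ⟨hpS, ε, hε, c, hc, κ, hκ, hext⟩ := hp
  have hn0 : n ≠ 0 := by omega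
  have hd0 : derivative (ofZeros z) ≠ 0 := by
    rw [hw]
    exact mul_ne_zero (C_ne_zero.2 (Nat.cast_ne_zero.2 hn0)) (ofZeros_monic w).ne_zero
  have hcrit (j) : (derivative (ofZeros z)).IsRoot (w j) :=
    (isRoot_derivative_iff_of_eq hn0 hw).2 ⟨j, rfl⟩
  have hne (j k) : w j ≠ z k := ne_of_isRoot_derivative hsimple (hcrit j) k
  have hsnd (j) := hsimple'.eval_derivative_ne_zero hd0 (hcrit j)
  choose K hK0 hK using fun j => exists_norm_sub_critVel_le (hne j) (hcrit j) (hsnd j)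
  obtain ⟨ρ, hρ, hρ0⟩ := ((eventually_all.2 hK).and self_mem_nhdsWithin).exists
  have hsv : Tendsto (fun s : ℝ => s • v) (𝓝[>] 0) (𝓝 0) := by
    have := (by fun_prop : Continuous fun s : ℝ => s • v).tendsto 0
    rw [zero_smul] at this
    exact this.mono_left nhdsWithin_le_nhds
  have hsmall (δ : ℝ) (hδ : 0 < δ) : ∀ᶠ s : ℝ in 𝓝[>] 0, ‖s • v‖ < δ := by
    have := hsv.norm
    rw [norm_zero] at this
    exact this.eventually_lt_const hδ
  have hdisk : ∀ᶠ s : ℝ in 𝓝[>] 0, ∀ k, ‖z k + (s • v) k‖ ≤ 1 := by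
    refine eventually_all.2 fun k => eventually_norm_add_smul_le_one (ofZeros_mem_S.1 hpS k) ?_
    intro hk
    have := hv (Sum.inr ⟨k, hk⟩)
    rwa [sum_A_inr_mul, Complex.neg_re, neg_pos] at this
  have hg : Tendsto (fun s : ℝ => c * ‖s • v‖ ^ (1 + κ) / s) (𝓝[>] 0) (𝓝 0) := by
    have hlim : Tendsto (fun s : ℝ => c * ‖v‖ ^ (1 + κ) * s ^ κ) (𝓝[>] 0) (𝓝 0) := by
      have := ((Real.continuousAt_rpow_const 0 κ (Or.inr hκ.le)).tendsto.const_mul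
        (c * ‖v‖ ^ (1 + κ))).mono_left (nhdsWithin_le_nhds (s := Set.Ioi 0))
      rwa [Real.zero_rpow hκ.ne', mul_zero] at this
    refine hlim.congr' ?_
    filter_upwards [self_mem_nhdsWithin] with s hs
    have hs' : 0 < s := hs
    rw [norm_smul, Real.norm_of_nonneg hs'.le, Real.mul_rpow hs'.le (norm_nonneg _),
      Real.rpow_add hs', Real.rpow_one]
    field_simp
  have hesc (j) : ∀ᶠ s : ℝ in 𝓝[>] 0, ∀ e : ℂ, ‖e‖ ≤ K j * ‖v‖ ^ 2 * s ^ 2 →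
      d (ofZeros z) + c * ‖s • v‖ ^ (1 + κ) <
        ‖w j - z i + s • (critVel z (w j) v - v i) + e‖ := by
    refine eventually_add_lt_norm hg (sub_ne_zero.2 (hne j i)) ?_
    have hle : d (ofZeros z) ≤ ‖w j - z i‖ := hi ▸ critDist_le (hcrit j)
    rcases hle.lt_or_eq with h | h
    · exact Or.inl h
    · refine Or.inr ⟨h, ?_⟩
      rw [← sum_alpha_mul (hne j) (hcrit j) (hsnd j)]
      exact hv (Sum.inl ⟨j, by rw [hi, h]⟩)
  have hnear := hsv.eventually (eventually_forall_isRoot_near hn0 z hρ0)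
  obtain ⟨s, hs1, hs2, hs3, hs4, hs5⟩ := ((eventually_all.2 hesc).and <|
    hdisk.and <| (hsmall ρ hρ0).and <| (hsmall ε hε).and hnear).exists
  have hqS : ofZeros (z + s • v) ∈ S n := ofZeros_mem_S.2 hs2
  have hdist : rootDist n (ofZeros (z + s • v)) (ofZeros z) ≤ ‖s • v‖ := by
    simpa using rootDist_ofZeros_le (z + s • v) z
  have hdist0 : 0 ≤ rootDist n (ofZeros (z + s • v)) (ofZeros z) :=
    Real.sInf_nonneg (by rintro _ ⟨_, _, _, _, rfl⟩; exact norm_nonneg _)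
  have hupper : d (ofZeros (z + s • v)) ≤ d (ofZeros z) + c * ‖s • v‖ ^ (1 + κ) := by
    refine (hext _ hqS (hdist.trans_lt hs4)).trans ?_
    gcongr
  obtain ⟨x', hx', hcd⟩ := exists_critDist_eq hn (z + s • v) ((z + s • v) i)
  obtain ⟨x, hx, hxx'⟩ := hs5 hs2 x' hx'
  obtain ⟨j, rfl⟩ := (isRoot_derivative_iff_of_eq hn0 hw).1 hx
  obtain ⟨u, rfl⟩ : ∃ u, x' = w j + u := ⟨x' - w j, (add_sub_cancel (w j) x').symm⟩
  rw [add_sub_cancel_left] at hxx'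
  have herr := hρ j (s • v) u hs3 hxx' hx'
  have hlower := hs1 j (u - critVel z (w j) (s • v)) (by
    refine herr.trans (le_of_eq ?_)
    rw [norm_smul, mul_pow, Real.norm_eq_abs, sq_abs]
    ring)
  have heq : w j - z i + s • (critVel z (w j) v - v i) + (u - critVel z (w j) (s • v)) =
      w j + u - (z + s • v) i := by
    rw [critVel_smul, Pi.add_apply, Pi.smul_apply, Complex.real_smul, Complex.real_smul]
    ring
  rw [heq, ← hcd] at hlower
  exact (hlower.trans_le (le_d_ofZeros _ i)).not_ge hupper

/-! ### The quadratic upper bound -/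

/-- A positively singular `A` prevents all the nearest critical points from moving away from `z i`
at first order while the zeros stay in the disk. -/
lemma PositivelySingular.exists_re_sum_alpha_nonpos {n : ℕ} {p : ℂ[X]} {z : Fin n → ℂ}
    {w : Fin (n - 1) → ℂ} {i : Fin n} (hA : PositivelySingular (A p z w i)) {h : Fin n → ℂ}
    (hh : ∀ k, ‖z k + h k‖ ≤ 1) :
    ∃ j, ‖w j - z i‖ = critDist p (z i) ∧ (∑ k, alpha p z i (w j) k * h k).re ≤ 0 := by
  obtain ⟨μ, hμ0, ⟨r₀, hr₀⟩, hμ⟩ := hA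
  by_contra! hpos
  have hsum : ∑ r, μ r * (∑ k, A p z w i r k * h k).re = 0 := by
    have h1 : ∑ r, (μ r : ℂ) * ∑ k, A p z w i r k * h k = 0 := by
      simp only [Finset.mul_sum]
      rw [Finset.sum_comm]
      refine Finset.sum_eq_zero fun k _ => ?_
      simp only [← mul_assoc]
      rw [← Finset.sum_mul, hμ k, zero_mul]
    simpa [Complex.re_sum, Complex.re_ofReal_mul] using congrArg Complex.re h1
  have hterm (r) : 0 ≤ (∑ k, A p z w i r k * h k).re := by
    rcases r with j | k
    · exact (hpos j j.2).le
    · rw [sum_A_inr_mul, Complex.neg_re, neg_nonneg]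
      exact re_conj_mul_nonpos k.2 (hh k)
  -- All terms vanish, so `μ` is supported on the zeros on the circle. These have independent rows,
  -- which forces `μ = 0`.
  have hzero := (Finset.sum_eq_zero_iff_of_nonneg
    fun r _ => mul_nonneg (hμ0 r) (hterm r)).1 hsum
  have hinl (j) : μ (Sum.inl j) = 0 :=
    (mul_eq_zero.1 (hzero (Sum.inl j) (Finset.mem_univ _))).resolve_right (hpos j j.2).ne'
  rcases r₀ with j | k
  · exact hr₀ (hinl j)
  · have hcol := hμ k
    rw [Fintype.sum_sum_type] at hcol
    have hz : starRingEnd ℂ (z k) ≠ 0 := by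
      rw [Ne, map_eq_zero, ← norm_eq_zero, k.2]
      exact one_ne_zero
    rw [Finset.sum_eq_zero fun j _ => by rw [hinl, Complex.ofReal_zero, zero_mul], zero_add,
      Finset.sum_eq_single k (fun k' _ hk' => by
        simp [A, (Subtype.coe_ne_coe.2 hk').symm]) (by simp)] at hcol
    simp only [A, if_true, mul_eq_zero, neg_eq_zero, Complex.ofReal_eq_zero] at hcol
    exact hcol.elim hr₀ hz

lemma exists_norm_critVel_le {ι : Type*} [Fintype ι] (z : ι → ℂ) (x : ℂ) :
    ∃ B : ℝ, 0 ≤ B ∧ ∀ h, ‖critVel z x h‖ ≤ B * ‖h‖ := by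
  refine ⟨(∑ k, 1 / ‖x - z k‖ ^ 2) / ‖∑ k, 1 / (x - z k) ^ 2‖, by positivity, fun h => ?_⟩
  rw [critVel, norm_div, div_mul_eq_mul_div, Finset.sum_mul]
  gcongr
  refine norm_sum_le_of_le _ fun k _ => ?_
  rw [norm_div, norm_pow, one_div_mul_eq_div]
  gcongr
  exact norm_le_pi_norm h k

/-- If a simple critical point `x` does not move away from `z i` at first order, then its distance to
`z i` increases at most quadratically. -/
lemma exists_critDist_le_of_re_nonpos {n : ℕ} (hn : n ≠ 0) {z : Fin n → ℂ} {x : ℂ}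
    (hx : ∀ k, x ≠ z k) (hc : (derivative (ofZeros z)).IsRoot x)
    (hs : (derivative (derivative (ofZeros z))).eval x ≠ 0) (i : Fin n) :
    ∃ K : ℝ, 0 ≤ K ∧ ∀ᶠ h in 𝓝 (0 : Fin n → ℂ),
      (∑ k, alpha (ofZeros z) z i x k * h k).re ≤ 0 →
        critDist (ofZeros (z + h)) ((z + h) i) ≤ ‖x - z i‖ + K * ‖h‖ ^ 2 := by
  obtain ⟨K, hK0, hK⟩ := exists_norm_sub_critVel_le hx hc hs
  obtain ⟨B, hB0, hB⟩ := exists_norm_critVel_le z x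
  obtain ⟨ρ, hρ, hρ0⟩ := (hK.and self_mem_nhdsWithin).exists
  have hρ0' : 0 < ρ := hρ0
  set a := x - z i with ha_def
  have ha : a ≠ 0 := sub_ne_zero.2 (hx i)
  have ha0 : 0 < ‖a‖ := norm_pos_iff.2 ha
  refine ⟨K + (B + 1 + K) ^ 2 / (2 * ‖a‖), by positivity, ?_⟩
  filter_upwards [eventually_exists_isRoot_near hn hc hρ0', Metric.ball_mem_nhds _ hρ0',
    Metric.ball_mem_nhds _ one_pos] with h ⟨u, hu, hroot⟩ hhρ hh1 hre
  rw [mem_ball_zero_iff] at hhρ hh1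
  have he := hρ h u hhρ hu hroot
  set e := u - critVel z x h with he_def
  refine (critDist_le hroot).trans ?_
  rw [sum_alpha_mul hx hc hs, ← ha_def] at hre
  have hfac : x + u - (z + h) i = a * (1 + ((critVel z x h - h i) / a + e / a)) := by
    rw [Pi.add_apply, he_def]
    field_simp
    rw [ha_def]
    ring
  set b := (critVel z x h - h i) / a + e / a with hb
  have hbre : b.re ≤ K * ‖h‖ ^ 2 / ‖a‖ := by
    rw [hb, Complex.add_re]
    have h1 : (e / a).re ≤ K * ‖h‖ ^ 2 / ‖a‖ := by
      refine (Complex.re_le_norm _).trans ?_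
      rw [norm_div]
      gcongr
    linarith
  have hbn : ‖b‖ ≤ (B + 1 + K) * ‖h‖ / ‖a‖ := by
    rw [hb, ← add_div, norm_div]
    gcongr
    have h1 : ‖e‖ ≤ K * ‖h‖ := he.trans (by
      gcongr
      exact pow_le_of_le_one (norm_nonneg _) hh1.le two_ne_zero)
    calc _ ≤ ‖critVel z x h‖ + ‖h i‖ + ‖e‖ :=
          (norm_add_le _ _).trans (by gcongr; exact norm_sub_le _ _)
      _ ≤ B * ‖h‖ + ‖h‖ + K * ‖h‖ := by
          gcongr
          exacts [hB h, norm_le_pi_norm h i]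
      _ = (B + 1 + K) * ‖h‖ := by ring
  rw [hfac, norm_mul]
  calc ‖a‖ * ‖1 + b‖ ≤ ‖a‖ * (1 + b.re + ‖b‖ ^ 2 / 2) := by
        gcongr
        exact norm_one_add_le b
    _ ≤ ‖a‖ * (1 + K * ‖h‖ ^ 2 / ‖a‖ + ((B + 1 + K) * ‖h‖ / ‖a‖) ^ 2 / 2) := by gcongr
    _ = ‖a‖ + (K + (B + 1 + K) ^ 2 / (2 * ‖a‖)) * ‖h‖ ^ 2 := by
        field_simp
        ring

/-- A strict inequality for the distance to the critical points persists under small perturbations. -/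
lemma eventually_critDist_le {n : ℕ} (hn : 2 ≤ n) {z : Fin n → ℂ} {i : Fin n} {D : ℝ}
    (hD : critDist (ofZeros z) (z i) < D) :
    ∀ᶠ h in 𝓝 (0 : Fin n → ℂ), critDist (ofZeros (z + h)) ((z + h) i) ≤ D := by
  obtain ⟨x, hx, hxd⟩ := exists_critDist_eq hn z (z i)
  have hρ : 0 < (D - critDist (ofZeros z) (z i)) / 2 := by linarith
  filter_upwards [eventually_exists_isRoot_near (by omega) hx hρ, Metric.ball_mem_nhds _ hρ]
    with h ⟨u, hu, hroot⟩ hh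
  rw [mem_ball_zero_iff] at hh
  have heq : x + u - (z + h) i = x - z i + u - h i := by
    rw [Pi.add_apply]
    ring
  have h1 := norm_sub_le (x - z i + u) (h i)
  have h2 := norm_add_le (x - z i) u
  have h3 := norm_le_pi_norm h i
  have h4 := critDist_le hroot (a := (z + h) i)
  rw [heq] at h4
  linarith

lemma exists_critDist_le_of_positivelySingular {n : ℕ} (hn : 2 ≤ n) {z : Fin n → ℂ}
    (hsimple : SimpleZeros (ofZeros z)) (hsimple' : SimpleZeros (derivative (ofZeros z)))
    {w : Fin (n - 1) → ℂ} (hw : derivative (ofZeros z) = C (n : ℂ) * ofZeros w) {i : Fin n}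
    (hA : PositivelySingular (A (ofZeros z) z w i)) :
    ∃ K : ℝ, 0 ≤ K ∧ ∀ᶠ h in 𝓝 (0 : Fin n → ℂ), (∀ k, ‖z k + h k‖ ≤ 1) →
      critDist (ofZeros (z + h)) ((z + h) i) ≤ critDist (ofZeros z) (z i) + K * ‖h‖ ^ 2 := by
  have hn0 : n ≠ 0 := by omega
  have hd0 : derivative (ofZeros z) ≠ 0 := by
    rw [hw]
    exact mul_ne_zero (C_ne_zero.2 (Nat.cast_ne_zero.2 hn0)) (ofZeros_monic w).ne_zero
  have hcrit (j) : (derivative (ofZeros z)).IsRoot (w j) :=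
    (isRoot_derivative_iff_of_eq hn0 hw).2 ⟨j, rfl⟩
  choose K hK0 hK using fun j => exists_critDist_le_of_re_nonpos hn0
    (ne_of_isRoot_derivative hsimple (hcrit j)) (hcrit j)
    (hsimple'.eval_derivative_ne_zero hd0 (hcrit j)) i
  refine ⟨∑ j, K j, Finset.sum_nonneg fun j _ => hK0 j, ?_⟩
  filter_upwards [eventually_all.2 hK] with h hh hdisk
  obtain ⟨j, hj, hre⟩ := hA.exists_re_sum_alpha_nonpos hdisk
  refine (hh j hre).trans ?_
  rw [hj]
  gcongr
  exact Finset.single_le_sum (fun j _ => hK0 j) (Finset.mem_univ j)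

/-- Quadratic upper bounds at all zeros give linear inextensibility with exponent `1 + 1`. -/
lemma linearlyInextensible_ofZeros {n : ℕ} (hn : 2 ≤ n) {z : Fin n → ℂ}
    (hz : Function.Injective z) (hp : ofZeros z ∈ S n)
    (h : ∀ i, ∃ K : ℝ, 0 ≤ K ∧ ∀ᶠ h in 𝓝 (0 : Fin n → ℂ), (∀ k, ‖z k + h k‖ ≤ 1) →
      critDist (ofZeros (z + h)) ((z + h) i) ≤ d (ofZeros z) + K * ‖h‖ ^ 2) :
    LinearlyInextensible n (ofZeros z) := by
  choose K hK0 hK using h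
  obtain ⟨ε, hε, hball⟩ := Metric.eventually_nhds_iff.1 (eventually_all.2 hK)
  refine ⟨hp, ε, hε, ∑ i, K i, Finset.sum_nonneg fun i _ => hK0 i, 1, one_pos, ?_⟩
  intro q hq hlt
  obtain ⟨ζ, rfl, hdist⟩ := exists_rootDist_eq hq hz
  rw [hdist] at hlt ⊢
  have hζ : z + (ζ - z) = ζ := add_sub_cancel z ζ
  refine d_ofZeros_le (by omega) fun i => ?_
  have hi := hball (y := ζ - z) (by rwa [dist_zero_right]) i fun k => by
    simpa using ofZeros_mem_S.1 hq k
  rw [hζ] at hi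
  refine hi.trans ?_
  rw [one_add_one_eq_two, Real.rpow_two]
  gcongr
  exact Finset.single_le_sum (fun j _ => hK0 j) (Finset.mem_univ i)

end Sendov

theorem theorem3p6 (n : ℕ) (hn : 3 ≤ n) (p : Polynomial ℂ) (hp : p ∈ Sendov.S n)
    (hsimple : Sendov.SimpleZeros p) (hsimple' : Sendov.SimpleZeros (Polynomial.derivative p))
    (z : Fin n → ℂ) (hz : p = ∏ i, (Polynomial.X - Polynomial.C (z i)))
    (w : Fin (n - 1) → ℂ)
    (hw : Polynomial.derivative p =
      Polynomial.C (n : ℂ) * ∏ j, (Polynomial.X - Polynomial.C (w j)))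
    (t : ℕ) (ht : 1 ≤ t) (htn : t ≤ n)
    (hmax : ∀ i : Fin n, (i : ℕ) < t → Sendov.critDist p (z i) = Sendov.d p)
    (hlt : ∀ i : Fin n, t ≤ (i : ℕ) → Sendov.critDist p (z i) < Sendov.d p) :
    Sendov.LinearlyInextensible n p ↔
      ∀ i : Fin n, (i : ℕ) < t → Sendov.PositivelySingular (Sendov.A p z w i) := by
  obtain rfl : p = Sendov.ofZeros z := hz
  have hn2 : 2 ≤ n := by omega
  refine ⟨fun h i hi => h.positivelySingular_A hn2 hsimple hsimple' hw (hmax i hi), fun h => ?_⟩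
  refine Sendov.linearlyInextensible_ofZeros hn2 hsimple.injective hp fun i => ?_
  rcases lt_or_ge (i : ℕ) t with hi | hi
  · rw [← hmax i hi]
    exact Sendov.exists_critDist_le_of_positivelySingular hn2 hsimple hsimple' hw (h i hi)
  · refine ⟨0, le_rfl, ?_⟩
    filter_upwards [Sendov.eventually_critDist_le hn2 (hlt i hi)] with h hh _
    rwa [zero_mul, add_zero]
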